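/- Let $\mu(G)$ denote the spectral radius of a finite simple graph $G$, that is, the largest eigenvalue of its adjacency matrix, and let $S_{n,k}=K_k\vee\overline{K_{n-k}}$ be the graph obtained by joining every vertex of a complete graph $K_k$ to every vertex of an independent set of order $n-k$. For $k\ge 4$, let $T_4$ (respectively $T_5$) be the tree of order $2k+3$ and diameter four that consists of a root joined to the centre of each of the $k$ components of the star forest $2K_{1,2}\cup(k-2)K_{1,1}$ (respectively $K_{1,3}\cup(k-1)K_{1,1}$), where either vertex of a $K_{1,1}$ may be taken as its centre. Then for every integer $k\ge 4$ there is an integer $N=N(k)$ such that for every $n\ge N$, every graph $G$ of order $n$ with $\mu(G)\ge\mu(S_{n,k})$ contains both $T_4$ and $T_5$ as (not necessarily induced) subgraphs. -/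

import Mathlib

namespace SpectralTrees

open Classical in
/-- The spectral radius `μ(G)` of a finite graph: the largest eigenvalue of its (real, symmetric)
adjacency matrix. -/
noncomputable def spectralRadius {V : Type*} [Fintype V] (G : SimpleGraph V) : ℝ :=
  sSup {x : ℝ | Module.End.HasEigenvalue (Matrix.toLin' (G.adjMatrix ℝ)) x}

open Classical in
/-- On a nonempty vertex set the supremum above is a genuine largest eigenvalue. -/
theorem isGreatest_spectralRadius {V : Type*} [Fintype V] [Nonempty V] (G : SimpleGraph V) :
    IsGreatest {x : ℝ | Module.End.HasEigenvalue (Matrix.toLin' (G.adjMatrix ℝ)) x}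
      (spectralRadius G) := by
  have hA : (G.adjMatrix ℝ).IsHermitian := by
    rw [Matrix.IsHermitian, Matrix.conjTranspose_eq_transpose_of_trivial,
      SimpleGraph.transpose_adjMatrix]
  have hspec : {x : ℝ | Module.End.HasEigenvalue (Matrix.toLin' (G.adjMatrix ℝ)) x} =
      Set.range hA.eigenvalues := by
    rw [← hA.spectrum_real_eq_range_eigenvalues, ← Matrix.spectrum_toLin']
    ext x
    exact Module.End.hasEigenvalue_iff_mem_spectrum
  have hne : {x : ℝ | Module.End.HasEigenvalue (Matrix.toLin' (G.adjMatrix ℝ)) x}.Nonempty := by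
    rw [hspec]
    exact Set.range_nonempty _
  have hfin : {x : ℝ | Module.End.HasEigenvalue (Matrix.toLin' (G.adjMatrix ℝ)) x}.Finite := by
    rw [hspec]
    exact Set.finite_range _
  exact ⟨hne.csSup_mem hfin, fun x hx => le_csSup hfin.bddAbove hx⟩

/-- The join `G ∨ H`: the disjoint union of `G` and `H` together with all edges between them. -/
def join {V W : Type*} (G : SimpleGraph V) (H : SimpleGraph W) : SimpleGraph (V ⊕ W) :=
  SimpleGraph.sum G H ⊔ completeBipartiteGraph V W

/-- The graph `S_{n,k}`, the join of a complete graph on `k` vertices and an edgeless graph on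
`n - k` vertices (of order `n` as soon as `k ≤ n`). -/
def splitGraph (n k : ℕ) : SimpleGraph (Fin k ⊕ Fin (n - k)) :=
  join (⊤ : SimpleGraph (Fin k)) (⊥ : SimpleGraph (Fin (n - k)))

/-- The rooted tree obtained from the disjoint union of the stars `K_{1,m 0}, …, K_{1,m (p-1)}` by
adding a root adjacent to the centre of each star. The root is `none`, the centre of the `i`-th
star is `some ⟨i, none⟩`, and its leaves are `some ⟨i, some j⟩`. -/
def rootedStars {p : ℕ} (m : Fin p → ℕ) : SimpleGraph (Option (Σ i : Fin p, Option (Fin (m i)))) :=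
  SimpleGraph.fromRel fun a b =>
    match a, b with
    | none, some ⟨_, none⟩ => True
    | some ⟨i, none⟩, some ⟨j, some _⟩ => i = j
    | _, _ => False

/-- The tree `T_4` with star forest `2K_{1,2} ∪ (k-2)K_2` below its root. -/
def treeFour (k : ℕ) :
    SimpleGraph (Option (Σ i : Fin k, Option (Fin (if i.val < 2 then 2 else 1)))) :=
  rootedStars fun i : Fin k => if i.val < 2 then 2 else 1

/-- The tree `T_5` with star forest `K_{1,3} ∪ (k-1)K_2` below its root. -/
def treeFive (k : ℕ) :
    SimpleGraph (Option (Σ i : Fin k, Option (Fin (if i.val < 1 then 3 else 1)))) :=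
  rootedStars fun i : Fin k => if i.val < 1 then 3 else 1

end SpectralTrees

namespace SpectralTrees

open Finset

/-! Only the number `k` of children of the root matters; the leaf counts affect just `N`. Once the
root and `k` centres of high degree are placed, the leaves fit (`rootedStars_isContained`). So a
graph avoiding the tree has bounded degeneracy, and any `k` of its vertices have boundedly many
common neighbours.

Scale a nonnegative subeigenvector to maximum 1, attained at `z`, and count two-step walks from `z`.
Sparsity bounds the number of vertices of non-negligible weight by a constant, so all but boundedly
many vertices have at most `k - 1` neighbours among them. The squared spectral radius is then at
most `(k - 3/4) n + O(1)`, below the `k (n - k)` forced by `S_{n,k}`. -/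

open Classical in
/-- If a root is adjacent to distinct vertices of large degree, then leaves can be attached to
these greedily. -/
theorem rootedStars_isContained {V : Type*} [Fintype V] {G : SimpleGraph V} {p : ℕ}
    {m : Fin p → ℕ} (r : V) (c : Fin p → V) (hc : Function.Injective c)
    (hr : ∀ i, G.Adj r (c i))
    (hdeg : ∀ i, ∑ i, m i + p + 1 ≤ #{w | G.Adj (c i) w}) :
    (rootedStars m).IsContained G := by
  let X : Finset V := insert r (univ.image c)
  have hX : #X ≤ p + 1 := by
    refine (card_insert_le _ _).trans ?_
    have := card_image_le (s := (univ : Finset (Fin p))) (f := c)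
    simp only [card_univ, Fintype.card_fin] at this
    omega
  let t : (Σ i : Fin p, Fin (m i)) → Finset V := fun a =>
    ({w | G.Adj (c a.1) w} : Finset V) \ X
  have ht : ∀ a, ∑ i, m i ≤ #(t a) := fun a => by
    have h1 := hdeg a.1
    have h2 := le_card_sdiff X ({w | G.Adj (c a.1) w} : Finset V)
    simp only [t]
    omega
  -- Hall's condition is immediate: each single candidate set is already at least as large as the
  -- total number of leaves.
  obtain ⟨f, hf, hft⟩ := (all_card_le_biUnion_card_iff_exists_injective t).1 fun s => by
    rcases s.eq_empty_or_nonempty with rfl | ⟨a, ha⟩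
    · simp
    · calc #s ≤ Fintype.card (Σ i : Fin p, Fin (m i)) := card_le_univ s
        _ = ∑ i, m i := by simp
        _ ≤ #(t a) := ht a
        _ ≤ _ := card_le_card (subset_biUnion_of_mem t ha)
  have hadj : ∀ i j, G.Adj (c i) (f ⟨i, j⟩) := fun i j => by
    have := hft ⟨i, j⟩
    simp only [t, mem_sdiff, mem_filter, mem_univ, true_and] at this
    exact this.1
  have hnr : ∀ a, f a ≠ r := fun a h => by
    have := hft a
    simp [t, X, h] at this
  have hnc : ∀ a i, f a ≠ c i := fun a i h => by
    have := hft a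
    simp [t, X, h] at this
  let g : Option (Σ i : Fin p, Option (Fin (m i))) → V
    | none => r
    | some ⟨i, none⟩ => c i
    | some ⟨i, some j⟩ => f ⟨i, j⟩
  have hg : Function.Injective g := by
    rintro (_ | ⟨i, _ | j⟩) (_ | ⟨i', _ | j'⟩) h
    · rfl
    · exact absurd h (hr i').ne
    · exact absurd h.symm (hnr _)
    · exact absurd h.symm (hr i).ne
    · obtain rfl := hc h
      rfl
    · exact absurd h.symm (hnc _ _)
    · exact absurd h (hnr _)
    · exact absurd h (hnc _ _)
    · have := hf h
      simp only [Sigma.mk.injEq] at this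
      obtain ⟨rfl, h2⟩ := this
      obtain rfl := eq_of_heq h2
      rfl
  have hrel : ∀ a b, (rootedStars m).Adj a b → G.Adj (g a) (g b) := by
    rintro (_ | ⟨i, _ | j⟩) (_ | ⟨i', _ | j'⟩) ⟨-, h⟩
    · simp at h
    · exact hr i'
    · simp at h
    · exact (hr i).symm
    · simp at h
    · obtain rfl : i = i' := by simpa using h
      exact hadj i j'
    · simp at h
    · obtain rfl : i' = i := by simpa using h
      exact (hadj i' j).symm
    · simp at h
  exact ⟨⟨⟨g, fun {a b} => hrel a b⟩, hg⟩⟩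

/-! ### Edge counts in sparse graphs -/

open Classical in
/-- In a graph of degeneracy at most `D`, every set `W` has degree sum at most `2 D |W|`. -/
theorem sum_card_adj_le {V : Type*} {G : SimpleGraph V} {D : ℕ}
    (hD : ∀ W : Finset V, W.Nonempty → ∃ v ∈ W, #{w ∈ W | G.Adj v w} ≤ D) (W : Finset V) :
    ∑ u ∈ W, #{w ∈ W | G.Adj u w} ≤ 2 * D * #W := by
  induction W using Finset.strongInduction with
  | H W ih =>
    rcases W.eq_empty_or_nonempty with rfl | hW
    · simp
    obtain ⟨v, hv, hvD⟩ := hD W hW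
    have hI := ih _ (erase_ssubset hv)
    have hcard := card_erase_add_one hv
    have hstep : ∀ u, #{w ∈ W | G.Adj u w} =
        #{w ∈ W.erase v | G.Adj u w} + if G.Adj u v then 1 else 0 := fun u => by
      rw [← insert_erase hv, filter_insert, erase_insert (notMem_erase v W)]
      split_ifs
      · rw [card_insert_of_notMem (by simp)]
      · rfl
    -- Edges at `v` are counted from both ends, hence the factor 2.
    have hback : ∑ u ∈ W.erase v, (if G.Adj u v then 1 else 0) ≤ #{w ∈ W | G.Adj v w} := by
      rw [← card_filter]
      refine card_le_card fun u hu => ?_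
      simp only [mem_filter, mem_erase] at hu ⊢
      exact ⟨hu.1.2, hu.2.symm⟩
    rw [← add_sum_erase W _ hv, sum_congr rfl fun u _ => hstep u, sum_add_distrib, ← hcard]
    linarith

open Classical in
/-- The edges between two sets in a locally sparse graph. -/
theorem sum_card_adj_le_add {V : Type*} {G : SimpleGraph V} {C : ℕ}
    (hC : ∀ W : Finset V, ∑ u ∈ W, #{w ∈ W | G.Adj u w} ≤ C * #W) (A B : Finset V) :
    ∑ u ∈ A, #{w ∈ B | G.Adj u w} ≤ C * (#A + #B) :=
  calc ∑ u ∈ A, #{w ∈ B | G.Adj u w}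
      ≤ ∑ u ∈ A ∪ B, #{w ∈ A ∪ B | G.Adj u w} :=
        (sum_le_sum fun _ _ => card_le_card (filter_subset_filter _ subset_union_right)).trans
          (sum_le_sum_of_subset subset_union_left)
    _ ≤ C * #(A ∪ B) := hC _
    _ ≤ C * (#A + #B) := Nat.mul_le_mul_left _ (card_union_le A B)

open Classical in
/-- If any `k` vertices have at most `q` common neighbours, then all but boundedly many vertices
have fewer than `k` neighbours in a given set `L`. -/
theorem sum_card_adj_le_of_common {V : Type*} [Fintype V] {G : SimpleGraph V} {k q : ℕ}
    (hk : 1 ≤ k) (hq : ∀ S : Finset V, #S = k → #{u | ∀ s ∈ S, G.Adj s u} ≤ q)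
    (A L : Finset V) :
    ∑ u ∈ A, #{w ∈ L | G.Adj u w} ≤ (k - 1) * #A + #L * (2 ^ #L * q) := by
  let B : Finset V := {u | k ≤ #{w ∈ L | G.Adj u w}}
  have hB : #B ≤ 2 ^ #L * q := by
    -- A vertex of `B` is a common neighbour of some `k`-subset of `L`, and there are at most `2 ^
    -- #L` of these.
    have hsub : B ⊆ (powersetCard k L).biUnion fun S => {u | ∀ s ∈ S, G.Adj s u} := fun u hu => by
      obtain ⟨S, hS, hSk⟩ := exists_subset_card_eq (mem_filter.1 hu).2
      refine mem_biUnion.2 ⟨S, mem_powersetCard.2 ⟨hS.trans (filter_subset _ _), hSk⟩, ?_⟩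
      simp only [mem_filter, mem_univ, true_and]
      exact fun s hs => (mem_filter.1 (hS hs)).2.symm
    refine (card_le_card hsub).trans ((card_biUnion_le_card_mul _ _ q fun S hS =>
      hq S (mem_powersetCard.1 hS).2).trans (Nat.mul_le_mul_right _ ?_))
    rw [← card_powerset]
    exact card_le_card fun S hS => mem_powerset.2 (mem_powersetCard.1 hS).1
  have hpt : ∀ u, #{w ∈ L | G.Adj u w} ≤ (k - 1) + if u ∈ B then #L else 0 := fun u => by
    split_ifs with h
    · exact (card_filter_le _ _).trans (Nat.le_add_left _ _)
    · simp only [B, mem_filter, mem_univ, true_and, not_le] at h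
      omega
  calc _ ≤ ∑ u ∈ A, ((k - 1) + if u ∈ B then #L else 0) := sum_le_sum fun _ _ => hpt _
    _ = (k - 1) * #A + #{u ∈ A | u ∈ B} * #L := by
      rw [sum_add_distrib, ← sum_filter]
      simp [mul_comm]
    _ ≤ (k - 1) * #A + #L * (2 ^ #L * q) := by
      rw [mul_comm _ #L]
      gcongr
      refine (card_le_card fun u hu => ?_).trans hB
      exact (mem_filter.1 hu).2

/-! ### Weights and two-step walks -/

open Classical in
/-- Splitting the two-step walks from `v` according to whether the weight at their end
is below `ε`. -/
theorem sq_mul_le_of_subeigenvector {V : Type*} [Fintype V] {G : SimpleGraph V} {C : ℕ}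
    (hC : ∀ W : Finset V, ∑ u ∈ W, #{w ∈ W | G.Adj u w} ≤ C * #W)
    {y : V → ℝ} {l ε : ℝ} (hl : 0 ≤ l) (hε : 0 ≤ ε) (hy1 : ∀ v, y v ≤ 1)
    (hy : ∀ v, l * y v ≤ ∑ u with G.Adj v u, y u) (v : V) :
    l ^ 2 * y v ≤ ε * (C * Fintype.card V) +
      ((∑ u with G.Adj v u, #{w ∈ ({w | ε ≤ y w} : Finset V) | G.Adj u w} : ℕ) : ℝ) := by
  set L : Finset V := {w | ε ≤ y w} with hL
  have hpt : ∀ w, y w ≤ ε + if w ∈ L then 1 else 0 := fun w => by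
    split_ifs with h
    · linarith [hy1 w]
    · simp only [hL, mem_filter, mem_univ, true_and, not_le] at h
      linarith
  have htot : ((∑ u with G.Adj v u, #{w | G.Adj u w} : ℕ) : ℝ) ≤ C * Fintype.card V := by
    have h1 : ∑ u with G.Adj v u, #{w | G.Adj u w} ≤ C * Fintype.card V :=
      (sum_le_sum_of_subset (filter_subset _ _)).trans (hC univ)
    exact_mod_cast h1
  have hin : ∀ u, l * y u ≤ ε * #{w | G.Adj u w} + #{w ∈ L | G.Adj u w} := fun u =>
    calc l * y u ≤ ∑ w with G.Adj u w, y w := hy u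
      _ ≤ ∑ w with G.Adj u w, (ε + if w ∈ L then 1 else 0) := sum_le_sum fun w _ => hpt w
      _ = ε * #{w | G.Adj u w} + #{w ∈ L | G.Adj u w} := by
        rw [sum_add_distrib, sum_const, nsmul_eq_mul, mul_comm, sum_boole, filter_filter]
        congr 3
        ext w
        simp [and_comm]
  calc l ^ 2 * y v = l * (l * y v) := by ring
    _ ≤ l * ∑ u with G.Adj v u, y u := mul_le_mul_of_nonneg_left (hy v) hl
    _ = ∑ u with G.Adj v u, l * y u := mul_sum _ _ _
    _ ≤ ∑ u with G.Adj v u, (ε * #{w | G.Adj u w} + #{w ∈ L | G.Adj u w}) :=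
      sum_le_sum fun u _ => hin u
    _ = ε * ((∑ u with G.Adj v u, #{w | G.Adj u w} : ℕ) : ℝ) +
        ((∑ u with G.Adj v u, #{w ∈ L | G.Adj u w} : ℕ) : ℝ) := by
      rw [sum_add_distrib, ← mul_sum]
      push_cast
      rfl
    _ ≤ _ := by gcongr

open Classical in
/-- A set of vertices of degree at least `d` in a sparse graph is small. -/
theorem card_mul_le_of_le_degree {V : Type*} [Fintype V] {G : SimpleGraph V} {C : ℕ}
    (hC : ∑ u : V, #{w | G.Adj u w} ≤ C * Fintype.card V) {d : ℝ} (L : Finset V)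
    (hL : ∀ v ∈ L, d ≤ #{w | G.Adj v w}) : #L * d ≤ C * Fintype.card V :=
  calc #L * d = ∑ v ∈ L, d := by simp
    _ ≤ ∑ v ∈ L, (#{w | G.Adj v w} : ℝ) := sum_le_sum hL
    _ ≤ ∑ v : V, (#{w | G.Adj v w} : ℝ) :=
      sum_le_sum_of_subset_of_nonneg (subset_univ _) fun _ _ _ => Nat.cast_nonneg _
    _ ≤ C * Fintype.card V := by exact_mod_cast hC

open Classical in
/-- A large sparse graph in which any `k` vertices have boundedly many common neighbours has a
spectral radius whose square is less than `k (n - k)`. -/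
theorem sq_lt_of_subeigenvector {V : Type*} [Fintype V] {G : SimpleGraph V} {C k q : ℕ}
    (hC1 : 1 ≤ C) (hk : 2 ≤ k)
    (hC : ∀ W : Finset V, ∑ u ∈ W, #{w ∈ W | G.Adj u w} ≤ C * #W)
    (hq : ∀ S : Finset V, #S = k → #{u | ∀ s ∈ S, G.Adj s u} ≤ q)
    (hn : 2 ^ 16 * C ^ 10 + 2 * (k ^ 2 + 8 * C ^ 3 * (2 ^ (8 * C ^ 3) * q)) + 2 * k
      ≤ Fintype.card V)
    {y : V → ℝ} {l : ℝ} (hl : 0 ≤ l) (hy1 : ∀ v, y v ≤ 1)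
    (hy : ∀ v, l * y v ≤ ∑ u with G.Adj v u, y u) {z : V} (hz : y z = 1) :
    l ^ 2 < k * (Fintype.card V - k) := by
  by_contra! hlk
  set n := Fintype.card V with hndef
  have hCr : (1 : ℝ) ≤ C := by exact_mod_cast hC1
  have hkr : (2 : ℝ) ≤ k := by exact_mod_cast hk
  have hnr : (2 ^ 16 * C ^ 10 + 2 * (k ^ 2 + 8 * C ^ 3 * (2 ^ (8 * C ^ 3) * q)) + 2 * k : ℝ) ≤ n := by
    exact_mod_cast hn
  have hq0 : (0 : ℝ) ≤ 8 * C ^ 3 * (2 ^ (8 * C ^ 3) * q) := by positivity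
  have hC10 : (1 : ℝ) ≤ C ^ 10 := one_le_pow₀ hCr
  have hn1 : (2 ^ 16 * C ^ 10 : ℝ) ≤ n := by nlinarith
  have hn2 : (2 * k : ℝ) ≤ n := by nlinarith
  have hn0 : (0 : ℝ) < n := by linarith
  have hln : (n : ℝ) ≤ l ^ 2 := by nlinarith
  have hC0 : (0 : ℝ) < C := by linarith
  have htot : ∑ u : V, #{w | G.Adj u w} ≤ C * n := hC univ
  have hdeg : ∀ v, l * y v ≤ #{w | G.Adj v w} := fun v => by
    refine (hy v).trans ((sum_le_sum fun u _ => hy1 u).trans ?_)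
    simp
  -- The vertices of weight at least `1 / (16 C ^ 2)` number at most `O(√n)`.
  set L₁ : Finset V := {w | 1 / (16 * C ^ 2 : ℝ) ≤ y w} with hL₁
  have hL₁card : (16 * C ^ 2 * #L₁ : ℝ) ≤ n := by
    have h := card_mul_le_of_le_degree htot (d := l * (1 / (16 * C ^ 2))) L₁ fun v hv =>
      (mul_le_mul_of_nonneg_left (mem_filter.1 hv).2 hl).trans (hdeg v)
    have h1 : #L₁ * l ≤ 16 * C ^ 3 * n := by
      have h2 : #L₁ * l = (#L₁ * (l * (1 / (16 * C ^ 2)))) * (16 * C ^ 2) := by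
        field_simp
      rw [h2]
      calc _ ≤ (C * n : ℝ) * (16 * C ^ 2) := by gcongr
        _ = _ := by ring
    have h2 : (#L₁ : ℝ) ^ 2 * n ≤ (256 * C ^ 6 * n) * n :=
      calc (#L₁ : ℝ) ^ 2 * n ≤ #L₁ ^ 2 * l ^ 2 := by gcongr
        _ = (#L₁ * l) ^ 2 := by ring
        _ ≤ (16 * C ^ 3 * n) ^ 2 := by gcongr
        _ = _ := by ring
    have h3 := le_of_mul_le_mul_right h2 hn0
    -- `#L₁` is at most `16 C ^ 3 √n`; the term `2 ^ 16 * C ^ 10` in the bound on `n` absorbs this.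
    refine (sq_le_sq₀ (by positivity) hn0.le).1 ?_
    calc (16 * C ^ 2 * #L₁ : ℝ) ^ 2 = (256 * C ^ 4 * #L₁ ^ 2 : ℝ) := by ring
      _ ≤ (256 * C ^ 4 * (256 * C ^ 6 * n) : ℝ) := by gcongr
      _ = (2 ^ 16 * C ^ 10 * n : ℝ) := by ring
      _ ≤ (n : ℝ) * n := by gcongr
      _ = (n : ℝ) ^ 2 := by ring
  -- Hence the vertices of weight at least `1 / (4 C)` have linear degree, and are few.
  set L₂ : Finset V := {w | 1 / (4 * C : ℝ) ≤ y w} with hL₂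
  have hL₂card : #L₂ ≤ 8 * C ^ 3 := by
    have h := card_mul_le_of_le_degree htot (d := n / (8 * C ^ 2)) L₂ fun v hv => by
      have hv' : 1 / (4 * C : ℝ) ≤ y v := (mem_filter.1 hv).2
      -- The light ends and `C * #L₁` each cost at most `n / (16 C)`, leaving half of `n / (4 C)`
      -- for `C` times the degree of `v`.
      have h1 := sq_mul_le_of_subeigenvector hC hl (ε := 1 / (16 * C ^ 2)) (by positivity) hy1 hy v
      have h2 : ((∑ u with G.Adj v u, #{w ∈ L₁ | G.Adj u w} : ℕ) : ℝ) ≤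
          C * (#{w | G.Adj v w} + #L₁) := by
        exact_mod_cast sum_card_adj_le_add hC {w | G.Adj v w} L₁
      have h3 : n * (1 / (4 * C : ℝ)) ≤ l ^ 2 * y v := by gcongr
      rw [div_le_iff₀ (by positivity)]
      have h4 : n * (1 / (4 * C : ℝ)) ≤ 1 / (16 * C ^ 2) * (C * n) +
          C * (#{w | G.Adj v w} + #L₁) := by linarith
      have h5 : n * (1 / (4 * C : ℝ)) * (16 * C) = 4 * n := by field_simp; norm_num
      have h6 : 1 / (16 * C ^ 2) * (C * n : ℝ) * (16 * C) = n := by field_simp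
      have h7 := mul_le_mul_of_nonneg_right h4 (show (0 : ℝ) ≤ 16 * C by positivity)
      linarith
    have h1 : (#L₂ : ℝ) * n ≤ (8 * C ^ 3) * n := by
      have h2 : (#L₂ : ℝ) * n = (#L₂ * (n / (8 * C ^ 2))) * (8 * C ^ 2) := by field_simp
      rw [h2]
      calc _ ≤ (C * n : ℝ) * (8 * C ^ 2) := by gcongr
        _ = _ := by ring
    exact_mod_cast le_of_mul_le_mul_right h1 hn0
  -- Count the walks of length two from the vertex of largest weight.
  have h1 := sq_mul_le_of_subeigenvector hC hl (ε := 1 / (4 * C)) (by positivity) hy1 hy z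
  have h2 := sum_card_adj_le_of_common (by omega) hq {u | G.Adj z u} L₂
  have h3 : (k - 1) * #{u | G.Adj z u} + #L₂ * (2 ^ #L₂ * q) ≤
      (k - 1) * n + 8 * C ^ 3 * (2 ^ (8 * C ^ 3) * q) := by
    gcongr
    · exact card_le_univ _
    · norm_num
  have h4 : ((∑ u with G.Adj z u, #{w ∈ L₂ | G.Adj u w} : ℕ) : ℝ) ≤
      (k - 1) * n + 8 * C ^ 3 * (2 ^ (8 * C ^ 3) * q) := by
    have := Nat.cast_le (α := ℝ).2 (h2.trans h3)
    push_cast [Nat.cast_sub (show 1 ≤ k by omega)] at this ⊢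
    exact this
  have h5 : 1 / (4 * C) * (C * n : ℝ) = n / 4 := by field_simp
  rw [hz, h5] at h1
  have h6 : l ^ 2 ≤ n / 4 + ((k - 1) * n + 8 * C ^ 3 * (2 ^ (8 * C ^ 3) * q)) := by linarith
  nlinarith

/-! ### Eigenvectors of `G` and of `S_{n,k}` -/

open Classical in
/-- The absolute values of an eigenvector form a subeigenvector, here scaled to maximum `1`. -/
theorem exists_subeigenvector {V : Type*} [Fintype V] [Nonempty V] (G : SimpleGraph V) :
    ∃ (y : V → ℝ) (z : V), (∀ v, y v ≤ 1) ∧ y z = 1 ∧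
      ∀ v, spectralRadius G * y v ≤ ∑ u with G.Adj v u, y u := by
  obtain ⟨x, hx⟩ := (isGreatest_spectralRadius G).1.exists_hasEigenvector
  obtain ⟨z, -, hz⟩ := exists_max_image univ (fun v => |x v|) univ_nonempty
  have hz0 : 0 < |x z| := by
    obtain ⟨v, hv⟩ := Function.ne_iff.1 hx.2
    exact (abs_pos.2 hv).trans_le (hz v (mem_univ v))
  refine ⟨fun v => |x v| / |x z|, z, fun v => (div_le_one hz0).2 (hz v (mem_univ v)),
    div_self hz0.ne', fun v => ?_⟩
  have he := congrFun hx.apply_eq_smul v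
  simp only [Matrix.toLin'_apply, SimpleGraph.adjMatrix_mulVec_apply, Pi.smul_apply,
    smul_eq_mul] at he
  rw [← sum_div, ← mul_div_assoc]
  refine div_le_div_of_nonneg_right ?_ hz0.le
  -- The triangle inequality suffices here, so Perron–Frobenius is not needed.
  calc spectralRadius G * |x v| ≤ |spectralRadius G| * |x v| := by
        gcongr
        exact le_abs_self _
    _ = |∑ u ∈ G.neighborFinset v, x u| := by rw [← abs_mul, he]
    _ ≤ ∑ u ∈ G.neighborFinset v, |x u| := abs_sum_le_sum_abs _ _
    _ = _ := by
      congr 1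
      ext u
      simp

open Classical in
theorem le_spectralRadius_of_mulVec_eq {V : Type*} [Fintype V] {G : SimpleGraph V} {l : ℝ}
    {x : V → ℝ} (hx : x ≠ 0) (h : (G.adjMatrix ℝ).mulVec x = l • x) : l ≤ spectralRadius G := by
  have : Nonempty V := not_isEmpty_iff.1 fun _ => hx (Subsingleton.elim _ _)
  refine (isGreatest_spectralRadius G).2 (Module.End.hasEigenvalue_of_hasEigenvector
    ⟨Module.End.mem_eigenspace_iff.2 ?_, hx⟩)
  rw [Matrix.toLin'_apply, h]

open Classical in
/-- The spectral radius of `S_{n,k}` is at least `√(k (n - k))`. -/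
theorem sqrt_le_spectralRadius_splitGraph {n k : ℕ} (hk : 1 ≤ k) (hkn : k < n) :
    √(k * (n - k)) ≤ spectralRadius (splitGraph n k) := by
  have hkr : (1 : ℝ) ≤ k := by exact_mod_cast hk
  have hknr : (k : ℝ) < n := by exact_mod_cast hkn
  have hP : (0 : ℝ) ≤ k * (n - k) := mul_nonneg (by linarith) (by linarith)
  -- The larger eigenvalue of the quotient matrix of the partition into clique and independent set.
  obtain ⟨l, hl, hll⟩ : ∃ l : ℝ, √(k * (n - k)) ≤ l ∧ l * l = (k - 1) * l + k * (n - k) := by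
    set s := √((k - 1) ^ 2 + 4 * (k * (n - k)) : ℝ) with hs
    have hss : s * s = (k - 1) ^ 2 + 4 * (k * (n - k)) := Real.mul_self_sqrt (by positivity)
    have hle : 2 * √(k * (n - k)) ≤ s := by
      refine Real.le_sqrt_of_sq_le ?_
      rw [mul_pow, Real.sq_sqrt hP]
      nlinarith [sq_nonneg ((k : ℝ) - 1)]
    refine ⟨((k - 1) + s) / 2, by linarith, by linarith⟩
  have hll' : ∀ a b : Fin k, (splitGraph n k).Adj (Sum.inl a) (Sum.inl b) ↔ a ≠ b := by
    simp [splitGraph, join]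
  have hlr : ∀ a b, (splitGraph n k).Adj (Sum.inl a) (Sum.inr b) := by simp [splitGraph, join]
  have hrr : ∀ a b, ¬ (splitGraph n k).Adj (Sum.inr a) (Sum.inr b) := by simp [splitGraph, join]
  refine hl.trans (le_spectralRadius_of_mulVec_eq
    (x := Sum.elim (fun _ => l) (fun _ => (k : ℝ))) ?_ ?_)
  · intro h
    have := congrFun h (Sum.inr ⟨0, by omega⟩)
    simp only [Sum.elim_inr, Pi.zero_apply] at this
    linarith
  · funext v
    rw [Pi.smul_apply, smul_eq_mul, Matrix.mulVec, dotProduct, Fintype.sum_sum_type]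
    rcases v with a | b
    · have h : ∀ i : Fin k, (if a ≠ i then (1 : ℝ) else 0) * l = l - if a = i then l else 0 := by
        intro i
        split_ifs <;> simp_all
      simp only [SimpleGraph.adjMatrix_apply, hll', hlr, Sum.elim_inl, Sum.elim_inr, h]
      simp [Nat.cast_sub hkn.le]
      linarith
    · simp only [SimpleGraph.adjMatrix_apply, hrr, (hlr _ _).symm, Sum.elim_inl, Sum.elim_inr]
      simp [mul_comm]

/-! ### Embedding the trees -/

/-- Every tree of height two whose root has `k ≥ 2` children lies in every large graph whose
spectral radius is at least that of `S_{n,k}`. -/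
theorem exists_forall_rootedStars_isContained {k : ℕ} (hk : 2 ≤ k) (m : Fin k → ℕ) :
    ∃ N : ℕ, ∀ n : ℕ, N ≤ n → ∀ (V : Type*) [Fintype V] (G : SimpleGraph V),
      Fintype.card V = n → spectralRadius (splitGraph n k) ≤ spectralRadius G →
        (rootedStars m).IsContained G := by
  classical
  set Q := ∑ i, m i + k + 1 with hQ
  refine ⟨2 ^ 16 * (2 * Q) ^ 10 +
    2 * (k ^ 2 + 8 * (2 * Q) ^ 3 * (2 ^ (8 * (2 * Q) ^ 3) * Q)) + 2 * k, ?_⟩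
  rintro n hn V _ G rfl hG
  by_contra hfree
  have hD : ∀ W : Finset V, W.Nonempty → ∃ v ∈ W, #{w ∈ W | G.Adj v w} ≤ Q := by
    rintro W ⟨r, hr⟩
    by_contra! h
    obtain ⟨S, hS, hSk⟩ := exists_subset_card_eq (show k ≤ #{w ∈ W | G.Adj r w} by
      have := h r hr
      omega)
    let c := (S.equivFinOfCardEq hSk).symm
    have hc : ∀ i, (c i : V) ∈ W ∧ G.Adj r (c i) := fun i => mem_filter.1 (hS (c i).2)
    exact hfree (rootedStars_isContained r (fun i => (c i : V))
      (Subtype.val_injective.comp c.injective) (fun i => (hc i).2) fun i =>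
        (h _ (hc i).1).le.trans (card_le_card (filter_subset_filter _ (subset_univ W))))
  have hq : ∀ S : Finset V, #S = k → #{u | ∀ s ∈ S, G.Adj s u} ≤ Q := by
    intro S hSk
    by_contra! h
    -- Any common neighbour serves as root and `S` as the centres; the many common neighbours also
    -- give the centres their degree.
    obtain ⟨r, hr⟩ := card_pos.1 (Nat.zero_lt_of_lt h)
    let c := (S.equivFinOfCardEq hSk).symm
    refine hfree (rootedStars_isContained r (fun i => (c i : V))
      (Subtype.val_injective.comp c.injective)
      (fun i => ((mem_filter.1 hr).2 _ (c i).2).symm) fun i => h.le.trans (card_le_card ?_))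
    intro u hu
    exact mem_filter.2 ⟨mem_univ u, (mem_filter.1 hu).2 _ (c i).2⟩
  have hkn : k < Fintype.card V := by omega
  have : Nonempty V := Fintype.card_pos_iff.1 (by omega)
  obtain ⟨y, z, hy1, hz, hy⟩ := exists_subeigenvector G
  have hle := (sqrt_le_spectralRadius_splitGraph (by omega) hkn).trans hG
  refine (sq_lt_of_subeigenvector (by omega) hk (sum_card_adj_le hD) hq hn
    ((Real.sqrt_nonneg _).trans hle) hy1 hy hz).not_ge ?_
  exact (Real.sqrt_le_left ((Real.sqrt_nonneg _).trans hle)).1 hle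

end SpectralTrees

theorem theorem4p1 (k : ℕ) (hk : 4 ≤ k) :
    ∃ N : ℕ, ∀ n : ℕ, N ≤ n →
      ∀ (V : Type*) [Fintype V] (G : SimpleGraph V), Fintype.card V = n →
        SpectralTrees.spectralRadius (SpectralTrees.splitGraph n k) ≤
            SpectralTrees.spectralRadius G →
          (SpectralTrees.treeFour k).IsContained G ∧ (SpectralTrees.treeFive k).IsContained G := by
  obtain ⟨N₁, h₁⟩ := SpectralTrees.exists_forall_rootedStars_isContained (by omega : 2 ≤ k)
    fun i => if i.val < 2 then 2 else 1
  obtain ⟨N₂, h₂⟩ := SpectralTrees.exists_forall_rootedStars_isContained (by omega : 2 ≤ k)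
    fun i => if i.val < 1 then 3 else 1
  exact ⟨max N₁ N₂, fun n hn V _ G hV hG =>
    ⟨h₁ n (le_of_max_le_left hn) V G hV hG, h₂ n (le_of_max_le_right hn) V G hV hG⟩⟩
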